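/- **Notation.** Let $m$ be a non-zero integer. The ring $\mathbb Z_m$ of $m$-adic integers is the projective limit of the rings $\mathbb Z/m^h\mathbb Z$, $h\ge 1$, with the projective limit topology. Let $\mathbb F_2$ be the free group on $a,b$. A marked group on two generators, up to marked isomorphism, is a quotient of $\mathbb F_2$. The set $\mathcal G_2$ of marked groups carries the metric for which two distinct marked groups are at distance $e^{-\lambda}$, where $\lambda$ is the length of a shortest $w\in\mathbb F_2$ that is trivial in one of them and not in the other. For $n\in\mathbb Z$ let $BS(m,n)=\langle a,b \mid ab^ma^{-1}=b^n\rangle$, marked by $(a,b)$. For $\xi\in\mathbb Z_m$ let $$\overline{BS}(m,\xi)=\lim BS(m,k)\in\mathcal G_2 ,$$ the limit being taken over the integers $k$ as $|k|\to\infty$ and $k\to\xi$ in $\mathbb Z_m$. Let $(\xi_n)_{n\in\mathbb N}$ be a sequence of integers with $|\xi_n|\to\infty$ and $\xi_n\to\xi$ in $\mathbb Z_m$. Let $H_n$ and $H_n^m$ be the subgroups of $BS(m,\xi_n)$ generated by $b$ and by $b^m$ respectively. The Bass–Serre tree of $BS(m,\xi_n)$ has vertex set $BS(m,\xi_n)/H_n$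 and set of positive edges $BS(m,\xi_n)/H_n^m$; the edge $wH_n^m$ goes from $wH_n$ to $wa^{-1}H_n$. Two sequences $(x_n)_n$, $(y_n)_n$ of vertices (or of positive edges) of these trees are identified if $x_n=y_n$ for all sufficiently large $n$. Let $X=X_{m,\xi}$ be the oriented graph whose vertices are the classes of the sequences $(wH_n)_n$, $w\in\mathbb F_2$, and whose positive edges are the classes of the sequences $(wH_n^m)_n$, $w\in\mathbb F_2$, the edge $(wH_n^m)_n$ having origin $(wH_n)_n$ and terminal vertex $(wa^{-1}H_n)_n$. The group $\mathbb F_2$ acts on $X$ by left multiplication. **Theorem.** Let $m\in\mathbb Z\setminus\{0\}$, $\xi\in\mathbb Z_m$, and let $(\xi_n)_n$ be a sequence of integers such that $|\xi_n|\to\infty$ and $\xi_n\to\xi$ in $\mathbb Z_m$. Then the limit defining $\overline{BS}(m,\xi)$ makes sense, that is, $BS(m,\xi_n)\to\overline{BS}(m,\xi)$ in $\mathcal G_2$, and the following hold. (a) The graph $X$, seen as unoriented, is a tree (in particular it has no loops and no multiple edges). (b) Up to $\mathbb F_2$-equivariant isomorphism (which can be chosen to preserve the orientation), $X$ does not depend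 on the choice of the auxiliary sequence: if $(\xi'_n)_n$ is another sequence of integers with $|\xi'_n|\to\infty$ and $\xi'_n\to\xi$ in $\mathbb Z_m$, then the graph built from $(\xi'_n)_n$ is $\mathbb F_2$-equivariantly isomorphic to $X$. (c) The action of $\mathbb F_2$ on $X$ factors through the canonical projection $\mathbb F_2\to\overline{BS}(m,\xi)$. -/

import Mathlib

open Filter Topology

/-! ### The ring of `m`-adic integers -/

/-- The ring `ℤ_m` of `m`-adic integers: the projective limit of the rings `ℤ/m^hℤ`
with respect to the canonical surjections, as a subring of the product.  Its topology is the one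
induced by the product of the discrete topologies. -/
def MAdicInt (m : ℤ) : Subring (∀ h : ℕ, ZMod (m.natAbs ^ h)) where
  carrier := {x | ∀ h, ZMod.castHom (pow_dvd_pow m.natAbs h.le_succ) (ZMod (m.natAbs ^ h))
    (x (h + 1)) = x h}
  mul_mem' hx hy h := by rw [Pi.mul_apply, map_mul, hx h, hy h]; rfl
  one_mem' h := by rw [Pi.one_apply, map_one]; rfl
  add_mem' hx hy h := by rw [Pi.add_apply, map_add, hx h, hy h]; rfl
  zero_mem' h := by rw [Pi.zero_apply, map_zero]; rfl
  neg_mem' hx h := by rw [Pi.neg_apply, map_neg, hx h]; rfl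

/-! ### Marked groups -/

/-- A marked group on `k` generators, up to isomorphism of marked groups: a quotient of the free
group on `k` generators, given by the normal subgroup `ker` of words that represent `1`. -/
@[ext]
structure MarkedGroup (k : ℕ) where
  ker : Subgroup (FreeGroup (Fin k))
  normal : ker.Normal

namespace MarkedGroup

attribute [instance] MarkedGroup.normal

/-- The underlying group of a marked group. -/
abbrev Carrier {k : ℕ} (G : MarkedGroup k) : Type := FreeGroup (Fin k) ⧸ G.ker

/-- The canonical projection from the free group. -/
abbrev proj {k : ℕ} (G : MarkedGroup k) : FreeGroup (Fin k) →* G.Carrier :=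
  QuotientGroup.mk' G.ker

instance (k : ℕ) : Inhabited (MarkedGroup k) := ⟨⟨⊥, inferInstance⟩⟩

/-- The lengths of the words that vanish in exactly one of the two marked groups. -/
def diffLengths {k : ℕ} (G H : MarkedGroup k) : Set ℕ :=
  {l | ∃ w : FreeGroup (Fin k), w.norm = l ∧ ¬ (w ∈ G.ker ↔ w ∈ H.ker)}

lemma diffLengths_nonempty {k : ℕ} {G H : MarkedGroup k} (h : G ≠ H) :
    (diffLengths G H).Nonempty := by
  by_contra hne
  apply h
  ext w
  by_contra hw
  exact hne ⟨w.norm, w, rfl, hw⟩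

lemma diffLengths_comm {k : ℕ} (G H : MarkedGroup k) : diffLengths G H = diffLengths H G := by
  ext l
  constructor <;> rintro ⟨w, hw, hne⟩ <;> exact ⟨w, hw, fun h => hne h.symm⟩

open Classical in
/-- The distance `e^{-l}` between distinct marked groups, where `l` is the length of a shortest
word that vanishes in one of the groups and not in the other one. -/
noncomputable def distance {k : ℕ} (G H : MarkedGroup k) : ℝ :=
  if G = H then 0 else Real.exp (-(sInf (diffLengths G H) : ℕ))

lemma distance_nonneg {k : ℕ} (G H : MarkedGroup k) : 0 ≤ distance G H := by
  unfold distance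
  split_ifs
  · exact le_rfl
  · exact (Real.exp_pos _).le

lemma distance_triangle {k : ℕ} (G H K : MarkedGroup k) :
    distance G K ≤ distance G H + distance H K := by
  by_cases hGK : G = K
  · have h0 : distance G K = 0 := if_pos hGK
    rw [h0]
    exact add_nonneg (distance_nonneg _ _) (distance_nonneg _ _)
  by_cases hGH : G = H
  · subst hGH
    exact le_add_of_nonneg_left (distance_nonneg _ _)
  by_cases hHK : H = K
  · subst hHK
    exact le_add_of_nonneg_right (distance_nonneg _ _)
  obtain ⟨w, hw, hne⟩ := Nat.sInf_mem (diffLengths_nonempty hGK)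
  by_cases h1 : (w ∈ G.ker ↔ w ∈ H.ker)
  · have h2 : ¬ (w ∈ H.ker ↔ w ∈ K.ker) := fun h => hne (h1.trans h)
    have hle : sInf (diffLengths H K) ≤ sInf (diffLengths G K) :=
      Nat.sInf_le ⟨w, hw, h2⟩
    refine le_trans ?_ (le_add_of_nonneg_left (distance_nonneg _ _))
    rw [distance, distance, if_neg hGK, if_neg hHK]
    exact Real.exp_le_exp.2 (neg_le_neg (by exact_mod_cast hle))
  · have hle : sInf (diffLengths G H) ≤ sInf (diffLengths G K) :=
      Nat.sInf_le ⟨w, hw, h1⟩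
    refine le_trans ?_ (le_add_of_nonneg_right (distance_nonneg _ _))
    rw [distance, distance, if_neg hGK, if_neg hGH]
    exact Real.exp_le_exp.2 (neg_le_neg (by exact_mod_cast hle))

/-- The space of marked groups on `k` generators. -/
noncomputable instance (k : ℕ) : MetricSpace (MarkedGroup k) where
  dist := distance
  dist_self G := if_pos rfl
  dist_comm G H := by
    by_cases h : G = H
    · rw [h]
    · rw [distance, distance, if_neg h, if_neg (Ne.symm h), diffLengths_comm]
  dist_triangle := distance_triangle
  eq_of_dist_eq_zero {G H} h := by
    by_contra hne
    change distance G H = 0 at h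
    rw [distance, if_neg hne] at h
    exact (Real.exp_pos _).ne' h

end MarkedGroup

/-! ### Baumslag-Solitar groups and their limits -/

/-- The first canonical generator `a` of the free group `𝔽₂`. -/
abbrev genA : FreeGroup (Fin 2) := FreeGroup.of 0

/-- The second canonical generator `b` of the free group `𝔽₂`. -/
abbrev genB : FreeGroup (Fin 2) := FreeGroup.of 1

/-- The group `BS(m,n) = ⟨a, b | a b^m a⁻¹ = b^n⟩`, marked by `(a, b)`. -/
def BS (m n : ℤ) : MarkedGroup 2 where
  ker := Subgroup.normalClosure {genA * genB ^ m * genA⁻¹ * (genB ^ n)⁻¹}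
  normal := Subgroup.normalClosure_normal

/-- The filter on `ℤ` that describes "`|k| → ∞` and `k → ξ` in `ℤ_m`". -/
noncomputable def approachFilter (m : ℤ) (ξ : MAdicInt m) : Filter ℤ :=
  comap (fun k : ℤ => |k|) atTop ⊓ comap (fun k : ℤ => (k : MAdicInt m)) (𝓝 ξ)

/-- The marked group `B̄S̄(m,ξ)`: the limit, in the space of marked groups, of `BS(m,k)` as the
rational integer `k` satisfies `|k| → ∞` and `k → ξ` in `ℤ_m`. -/
noncomputable def BSbar (m : ℤ) (ξ : MAdicInt m) : MarkedGroup 2 :=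
  limUnder (approachFilter m ξ) (fun k => BS m k)

/-! ### Oriented graphs -/

/-- An oriented graph: vertices, positively oriented edges, origin and terminal vertex of an
edge.  Loops and multiple edges are allowed. -/
structure OrientedGraph where
  V : Type
  E : Type
  o : E → V
  t : E → V

namespace OrientedGraph

/-- The simple graph obtained by forgetting the orientation (and loops and multiplicities). -/
def toSimpleGraph (X : OrientedGraph) : SimpleGraph X.V where
  Adj v w := v ≠ w ∧ ∃ e, (X.o e = v ∧ X.t e = w) ∨ (X.o e = w ∧ X.t e = v)
  symm := ⟨fun _ _ ⟨h, e, he⟩ => ⟨h.symm, e, he.symm⟩⟩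
  loopless := ⟨fun _ h => h.1 rfl⟩

/-- `X`, seen as unoriented, is a tree: it has no loops and no multiple edges (in particular no
pair of edges with opposite directions), it is non-empty and connected and has no cycles. -/
def IsTree (X : OrientedGraph) : Prop :=
  (∀ e, X.o e ≠ X.t e) ∧ Function.Injective (fun e => s(X.o e, X.t e)) ∧ X.toSimpleGraph.IsTree

/-- The group of (orientation preserving) automorphisms of an oriented graph. -/
def Aut (X : OrientedGraph) : Subgroup (Equiv.Perm X.V × Equiv.Perm X.E) where
  carrier := {p | ∀ e, X.o (p.2 e) = p.1 (X.o e) ∧ X.t (p.2 e) = p.1 (X.t e)}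
  mul_mem' {p q} hp hq e := by
    refine ⟨?_, ?_⟩
    · change X.o (p.2 (q.2 e)) = p.1 (q.1 (X.o e))
      rw [(hp _).1, (hq _).1]
    · change X.t (p.2 (q.2 e)) = p.1 (q.1 (X.t e))
      rw [(hp _).2, (hq _).2]
  one_mem' _ := ⟨rfl, rfl⟩
  inv_mem' {p} hp e := by
    have h := hp (p.2.symm e)
    rw [Equiv.apply_symm_apply] at h
    change X.o (p.2.symm e) = p.1.symm (X.o e) ∧ X.t (p.2.symm e) = p.1.symm (X.t e)
    rw [h.1, h.2]
    exact ⟨(Equiv.symm_apply_apply _ _).symm, (Equiv.symm_apply_apply _ _).symm⟩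

/-- An isomorphism of oriented graphs. -/
structure Iso (X Y : OrientedGraph) where
  onV : X.V ≃ Y.V
  onE : X.E ≃ Y.E
  map_o : ∀ e, Y.o (onE e) = onV (X.o e)
  map_t : ∀ e, Y.t (onE e) = onV (X.t e)

/-- Equivariance of an isomorphism with respect to actions of the group `Γ` by automorphisms. -/
def Iso.Equivariant {X Y : OrientedGraph} (φ : Iso X Y) {Γ : Type} [Group Γ]
    (ρ : Γ →* X.Aut) (τ : Γ →* Y.Aut) : Prop :=
  ∀ g, (∀ v, φ.onV ((ρ g).1.1 v) = (τ g).1.1 (φ.onV v)) ∧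
    ∀ e, φ.onE ((ρ g).1.2 e) = (τ g).1.2 (φ.onE e)

end OrientedGraph

/-! ### The Bass-Serre tree of `BS(m,n)` -/

/-- The subgroup `⟨b⟩` of `BS(m,n)`. -/
def subgroupB (m n : ℤ) : Subgroup (BS m n).Carrier := Subgroup.zpowers ((BS m n).proj genB)

/-- The subgroup `⟨b^m⟩` of `BS(m,n)`. -/
def subgroupBm (m n : ℤ) : Subgroup (BS m n).Carrier :=
  Subgroup.zpowers ((BS m n).proj genB ^ m)

lemma subgroupBm_le (m n : ℤ) : subgroupBm m n ≤ subgroupB m n := by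
  rw [subgroupBm, Subgroup.zpowers_le]
  exact Subgroup.zpow_mem _ (Subgroup.mem_zpowers _) _

lemma BS_relation (m n : ℤ) :
    (BS m n).proj genA * (BS m n).proj genB ^ m * ((BS m n).proj genA)⁻¹ =
      (BS m n).proj genB ^ n := by
  have h : (BS m n).proj (genA * genB ^ m * genA⁻¹ * (genB ^ n)⁻¹) = 1 :=
    (QuotientGroup.eq_one_iff _).2 (Subgroup.subset_normalClosure rfl)
  rw [map_mul, map_inv] at h
  have h' := mul_inv_eq_one.1 h
  simpa only [map_mul, map_inv, map_zpow] using h'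

lemma conj_mem_subgroupB (m n : ℤ) {x : (BS m n).Carrier} (hx : x ∈ subgroupBm m n) :
    (BS m n).proj genA * x * ((BS m n).proj genA)⁻¹ ∈ subgroupB m n := by
  obtain ⟨k, rfl⟩ := Subgroup.mem_zpowers_iff.1 hx
  rw [← conj_zpow, BS_relation]
  exact Subgroup.zpow_mem _ (Subgroup.zpow_mem _ (Subgroup.mem_zpowers _) _) _

/-- The Bass-Serre tree of `BS(m,n)`: the vertices are the cosets `w⟨b⟩`, the positive edges are
the cosets `w⟨b^m⟩`, with `o(w⟨b^m⟩) = w⟨b⟩` and `t(w⟨b^m⟩) = w a⁻¹⟨b⟩`. -/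
def bassSerre (m n : ℤ) : OrientedGraph where
  V := (BS m n).Carrier ⧸ subgroupB m n
  E := (BS m n).Carrier ⧸ subgroupBm m n
  o := Quotient.map' (fun w => w) (fun v w h => by
    rw [QuotientGroup.leftRel_apply] at h ⊢
    exact subgroupBm_le m n h)
  t := Quotient.map' (fun w => w * ((BS m n).proj genA)⁻¹) (fun v w h => by
    rw [QuotientGroup.leftRel_apply] at h ⊢
    have h2 := conj_mem_subgroupB m n h
    simpa only [mul_inv_rev, inv_inv, mul_assoc] using h2)

/-- The vertex `w⟨b⟩` of the Bass-Serre tree. -/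
def bsVertex (m n : ℤ) (w : FreeGroup (Fin 2)) : (bassSerre m n).V :=
  QuotientGroup.mk ((BS m n).proj w)

/-- The positive edge `w⟨b^m⟩` of the Bass-Serre tree. -/
def bsEdge (m n : ℤ) (w : FreeGroup (Fin 2)) : (bassSerre m n).E :=
  QuotientGroup.mk ((BS m n).proj w)

/-- Left multiplication by the image of the word `v` in `BS(m,n)` on the vertices `w⟨b⟩`. -/
def bsVSmul (m n : ℤ) (v : FreeGroup (Fin 2)) :
    (BS m n).Carrier ⧸ subgroupB m n → (BS m n).Carrier ⧸ subgroupB m n :=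
  fun x => (BS m n).proj v • x

/-- Left multiplication by the image of the word `v` in `BS(m,n)` on the edges `w⟨b^m⟩`. -/
def bsESmul (m n : ℤ) (v : FreeGroup (Fin 2)) :
    (BS m n).Carrier ⧸ subgroupBm m n → (BS m n).Carrier ⧸ subgroupBm m n :=
  fun x => (BS m n).proj v • x

/-! ### The limit of the Bass-Serre trees -/

/-- The set `Y`: sequences of vertices of the trees of `BS(m,ξ_n)`, where sequences that agree for
all large `n` are identified. -/
abbrev SeqV (m : ℤ) (ξ : ℕ → ℤ) : Type :=
  Filter.Product (atTop : Filter ℕ) (fun n => (bassSerre m (ξ n)).V)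

/-- The set `Y^m`: sequences of edges of the trees of `BS(m,ξ_n)`, where sequences that agree for
all large `n` are identified. -/
abbrev SeqE (m : ℤ) (ξ : ℕ → ℤ) : Type :=
  Filter.Product (atTop : Filter ℕ) (fun n => (bassSerre m (ξ n)).E)

/-- The class of the sequence `(w⟨b⟩)_n`. -/
def limVertex (m : ℤ) (ξ : ℕ → ℤ) (w : FreeGroup (Fin 2)) : SeqV m ξ :=
  Quotient.mk'' (fun n => bsVertex m (ξ n) w)

/-- The class of the sequence `(w⟨b^m⟩)_n`. -/
def limEdge (m : ℤ) (ξ : ℕ → ℤ) (w : FreeGroup (Fin 2)) : SeqE m ξ :=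
  Quotient.mk'' (fun n => bsEdge m (ξ n) w)

/-- The origin map, applied termwise to sequences of edges. -/
def seqOrigin (m : ℤ) (ξ : ℕ → ℤ) : SeqE m ξ → SeqV m ξ :=
  Quotient.map' (fun x n => (bassSerre m (ξ n)).o (x n))
    (fun _ _ h => h.mono fun n hn => congrArg (bassSerre m (ξ n)).o hn)

/-- The terminal vertex map, applied termwise to sequences of edges. -/
def seqTerminus (m : ℤ) (ξ : ℕ → ℤ) : SeqE m ξ → SeqV m ξ :=
  Quotient.map' (fun x n => (bassSerre m (ξ n)).t (x n))
    (fun _ _ h => h.mono fun n hn => congrArg (bassSerre m (ξ n)).t hn)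

lemma seqOrigin_limEdge (m : ℤ) (ξ : ℕ → ℤ) (w : FreeGroup (Fin 2)) :
    seqOrigin m ξ (limEdge m ξ w) = limVertex m ξ w := rfl

lemma seqTerminus_limEdge (m : ℤ) (ξ : ℕ → ℤ) (w : FreeGroup (Fin 2)) :
    seqTerminus m ξ (limEdge m ξ w) = limVertex m ξ (w * genA⁻¹) := rfl

/-- The oriented graph `X` built from the sequence `ξ`. -/
def limitGraph (m : ℤ) (ξ : ℕ → ℤ) : OrientedGraph where
  V := {x : SeqV m ξ // ∃ w, x = limVertex m ξ w}
  E := {y : SeqE m ξ // ∃ w, y = limEdge m ξ w}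
  o e := ⟨seqOrigin m ξ e.1, by
    obtain ⟨_, w, rfl⟩ := e
    exact ⟨w, seqOrigin_limEdge m ξ w⟩⟩
  t e := ⟨seqTerminus m ξ e.1, by
    obtain ⟨_, w, rfl⟩ := e
    exact ⟨w * genA⁻¹, seqTerminus_limEdge m ξ w⟩⟩

/-- Termwise left multiplication by a word on sequences of vertices. -/
def seqVSmul (m : ℤ) (ξ : ℕ → ℤ) (v : FreeGroup (Fin 2)) : SeqV m ξ → SeqV m ξ :=
  Quotient.map' (fun x n => bsVSmul m (ξ n) v (x n))
    (fun _ _ h => h.mono fun n hn => congrArg (bsVSmul m (ξ n) v) hn)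

/-- Termwise left multiplication by a word on sequences of edges. -/
def seqESmul (m : ℤ) (ξ : ℕ → ℤ) (v : FreeGroup (Fin 2)) : SeqE m ξ → SeqE m ξ :=
  Quotient.map' (fun x n => bsESmul m (ξ n) v (x n))
    (fun _ _ h => h.mono fun n hn => congrArg (bsESmul m (ξ n) v) hn)

lemma seqVSmul_limVertex (m : ℤ) (ξ : ℕ → ℤ) (v w : FreeGroup (Fin 2)) :
    seqVSmul m ξ v (limVertex m ξ w) = limVertex m ξ (v * w) := rfl

lemma seqESmul_limEdge (m : ℤ) (ξ : ℕ → ℤ) (v w : FreeGroup (Fin 2)) :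
    seqESmul m ξ v (limEdge m ξ w) = limEdge m ξ (v * w) := rfl

instance (m : ℤ) (ξ : ℕ → ℤ) : MulAction (FreeGroup (Fin 2)) (limitGraph m ξ).V where
  smul v x := ⟨seqVSmul m ξ v x.1, by
    obtain ⟨_, w, rfl⟩ := x
    exact ⟨v * w, seqVSmul_limVertex m ξ v w⟩⟩
  one_smul := by
    rintro ⟨_, w, rfl⟩
    apply Subtype.ext
    change seqVSmul m ξ 1 (limVertex m ξ w) = _
    rw [seqVSmul_limVertex, one_mul]
  mul_smul u v := by
    rintro ⟨_, w, rfl⟩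
    apply Subtype.ext
    change seqVSmul m ξ (u * v) (limVertex m ξ w) =
      seqVSmul m ξ u (seqVSmul m ξ v (limVertex m ξ w))
    simp only [seqVSmul_limVertex, mul_assoc]

instance (m : ℤ) (ξ : ℕ → ℤ) : MulAction (FreeGroup (Fin 2)) (limitGraph m ξ).E where
  smul v x := ⟨seqESmul m ξ v x.1, by
    obtain ⟨_, w, rfl⟩ := x
    exact ⟨v * w, seqESmul_limEdge m ξ v w⟩⟩
  one_smul := by
    rintro ⟨_, w, rfl⟩
    apply Subtype.ext
    change seqESmul m ξ 1 (limEdge m ξ w) = _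
    rw [seqESmul_limEdge, one_mul]
  mul_smul u v := by
    rintro ⟨_, w, rfl⟩
    apply Subtype.ext
    change seqESmul m ξ (u * v) (limEdge m ξ w) =
      seqESmul m ξ u (seqESmul m ξ v (limEdge m ξ w))
    simp only [seqESmul_limEdge, mul_assoc]

/-- The action of the free group `𝔽₂` on the graph `X` by left multiplication. -/
def limitAction (m : ℤ) (ξ : ℕ → ℤ) : FreeGroup (Fin 2) →* (limitGraph m ξ).Aut :=
  MonoidHom.codRestrict
    ((MulAction.toPermHom (FreeGroup (Fin 2)) (limitGraph m ξ).V).prod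
      (MulAction.toPermHom (FreeGroup (Fin 2)) (limitGraph m ξ).E))
    (limitGraph m ξ).Aut (by
      rintro v ⟨_, w, rfl⟩
      refine ⟨Subtype.ext ?_, Subtype.ext ?_⟩
      · change seqOrigin m ξ (seqESmul m ξ v (limEdge m ξ w)) =
          seqVSmul m ξ v (seqOrigin m ξ (limEdge m ξ w))
        rw [seqESmul_limEdge, seqOrigin_limEdge, seqOrigin_limEdge, seqVSmul_limVertex]
      · change seqTerminus m ξ (seqESmul m ξ v (limEdge m ξ w)) =
          seqVSmul m ξ v (seqTerminus m ξ (limEdge m ξ w))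
        rw [seqESmul_limEdge, seqTerminus_limEdge, seqTerminus_limEdge, seqVSmul_limVertex,
          mul_assoc])

/-!
Everything reduces to one uniformity statement about words. Let the integer `k` tend to infinity
and to `ξ` in `ℤ_m`. Rewriting a word of `𝔽₂` to a reduced word of the HNN extension `BS(m,k)`
requires deciding, for exponents `c` of `b`, whether `m` or `k` divides `c`, and replaces `c` by
`k * (c / m)` or by `m * (c / k)`. All exponents that occur are values at `k` of polynomials with
coefficients in `ℤ[1/m]` (`EventuallyPolynomial`). For such `c`, divisibility by `m` is decided by
the residue of `k` modulo a power of `m`; divisibility by `k` forces the constant term to vanish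
for large `k`, and is then decided by such a residue too; and `c k = 0` is decided for large `k`
because a nonzero polynomial has finitely many roots. Hence the reduction of a word takes the same
steps for all `k` close enough to the limit (`exists_isUniformForm`), and with Britton's lemma
(`map_fst_eq_of_bsWord_eq`), the membership of a word in the kernel, in `⟨b⟩` or in `⟨b ^ m⟩` is
eventually constant.

For the kernel this is the convergence of `BS(m,k)` (`tendsto_BSbar`). For the two subgroups it
says that equality of vertices and of edges of `X` is decided by the filter that defines the limit
and not by the sequence (`limVertex_eq_iff`, `limEdge_eq_iff`), which gives (b) and (c).

For (a), the absence of loops and of multiple edges comes from Britton's lemma, and `X` is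
connected because the words `w * b` and `w * a⁻¹` give the vertex of `w` and a neighbour of it. The
eventual number of letters `a`, `a⁻¹` in the reduced form is a depth function on the vertices
(`exists_depth`). A vertex has at most one neighbour that is not deeper, since this holds in
each Bass-Serre tree (`BSNeighbour.mul_inv_mem`), so there are no cycles
(`SimpleGraph.isAcyclic_of_depth`).
-/

/-! ### Reduced words in Baumslag-Solitar groups -/

/-- The index of the subgroup of `⟨b⟩` that is conjugated into `⟨b⟩` by `a ^ u`: it is `m` for
`u = 1` and `n` for `u = -1`. -/
def bsIndex (m n : ℤ) (u : ℤˣ) : ℤ := if u = 1 then m else n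

/-- The element `b ^ c * a ^ u₁ * b ^ d₁ * ⋯ * a ^ uₗ * b ^ dₗ` of `BS(m,n)`, where `L` is the
list of the pairs `(uᵢ, dᵢ)`. -/
def bsWord (m n c : ℤ) (L : List (ℤˣ × ℤ)) : (BS m n).Carrier :=
  (BS m n).proj genB ^ c *
    (L.map fun x => (BS m n).proj genA ^ (x.1 : ℤ) * (BS m n).proj genB ^ x.2).prod

/-- The word given by `L` is reduced: it contains neither `a * b ^ (m * d) * a⁻¹` nor
`a⁻¹ * b ^ (n * d) * a`. -/
def BSReduced (m n : ℤ) (L : List (ℤˣ × ℤ)) : Prop :=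
  L.IsChain fun x y => bsIndex m n x.1 ∣ x.2 → x.1 = y.1

lemma zpow_mul_bsWord (m n i c : ℤ) (L : List (ℤˣ × ℤ)) :
    (BS m n).proj genB ^ i * bsWord m n c L = bsWord m n (i + c) L := by
  rw [bsWord, bsWord, zpow_add, mul_assoc]

lemma bsWord_cons (m n j c : ℤ) (u : ℤˣ) (L : List (ℤˣ × ℤ)) :
    bsWord m n j ((u, c) :: L) =
      (BS m n).proj genB ^ j * ((BS m n).proj genA ^ (u : ℤ) * bsWord m n c L) := by
  simp only [bsWord, List.map_cons, List.prod_cons, mul_assoc]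

lemma bsWord_nil (m n c : ℤ) : bsWord m n c [] = (BS m n).proj genB ^ c := by
  simp [bsWord]

lemma genA_conj_zpow (m n d : ℤ) (u : ℤˣ) :
    (BS m n).proj genA ^ (u : ℤ) * (BS m n).proj genB ^ (bsIndex m n u * d) =
      (BS m n).proj genB ^ (bsIndex m n (-u) * d) * (BS m n).proj genA ^ (u : ℤ) := by
  have h := BS_relation m n
  have key : (BS m n).proj genA * (BS m n).proj genB ^ (m * d) * ((BS m n).proj genA)⁻¹ =
      (BS m n).proj genB ^ (n * d) := by
    rw [zpow_mul, ← conj_zpow, h, ← zpow_mul]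
  rcases Int.units_eq_one_or u with rfl | rfl
  · have h1 : bsIndex m n 1 = m := rfl
    have h2 : bsIndex m n (-1) = n := rfl
    rw [h1, h2, ← key]
    simp
  · have h1 : bsIndex m n (- -1) = m := rfl
    have h2 : bsIndex m n (-1) = n := rfl
    rw [h1, h2, ← key]
    simp [mul_assoc]

lemma bsWord_cancel (m n c d : ℤ) (u : ℤˣ) (L : List (ℤˣ × ℤ)) :
    (BS m n).proj genA ^ (u : ℤ) * bsWord m n (bsIndex m n u * d) ((-u, c) :: L) =
      bsWord m n (bsIndex m n (-u) * d + c) L := by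
  rw [bsWord_cons, ← mul_assoc, genA_conj_zpow, mul_assoc, Units.val_neg, zpow_neg,
    mul_inv_cancel_left, zpow_mul_bsWord]

lemma BSReduced.cons {m n c : ℤ} {u : ℤˣ} {L : List (ℤˣ × ℤ)} (hL : BSReduced m n L)
    (h : ∀ y ∈ L.head?, bsIndex m n u ∣ c → u = y.1) : BSReduced m n ((u, c) :: L) :=
  List.isChain_cons.2 ⟨h, hL⟩

lemma BSReduced.tail {m n : ℤ} {L : List (ℤˣ × ℤ)} (hL : BSReduced m n L) :
    BSReduced m n L.tail :=
  List.IsChain.tail hL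

/-- A neighbour of the coset of a reduced element in the tree is either represented by a reduced
word with one more letter, or it is the coset obtained by removing the first letter. -/
lemma bsWord_neighbour (m n i j c : ℤ) (u : ℤˣ) {L : List (ℤˣ × ℤ)} (hL : BSReduced m n L) :
    (∃ c' L', (BS m n).proj genB ^ j * ((BS m n).proj genA ^ (u : ℤ) *
      ((BS m n).proj genB ^ i * bsWord m n c L)) = bsWord m n c' L' ∧ BSReduced m n L' ∧
        L'.length = L.length + 1) ∨
    ∃ c', (BS m n).proj genB ^ j * ((BS m n).proj genA ^ (u : ℤ) *
      ((BS m n).proj genB ^ i * bsWord m n c L)) = bsWord m n c' L.tail := by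
  rw [zpow_mul_bsWord]
  by_cases h : ∀ y ∈ L.head?, bsIndex m n u ∣ i + c → u = y.1
  · exact Or.inl ⟨j, (u, i + c) :: L, (bsWord_cons ..).symm, hL.cons h, rfl⟩
  · push Not at h
    obtain ⟨⟨v, c'⟩, hy, ⟨d, hd⟩, hne⟩ := h
    right
    cases L with
    | nil => simp at hy
    | cons z L =>
      simp only [List.head?_cons, Option.mem_def, Option.some.injEq] at hy
      subst hy
      have hv : v = -u := by
        rw [Int.units_ne_iff_eq_neg.1 hne, neg_neg]
      subst hv
      exact ⟨j + (bsIndex m n (-u) * d + c'), by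
        rw [hd, bsWord_cancel, zpow_mul_bsWord, List.tail_cons]⟩

/-! ### Britton's lemma -/

/-- Multiplication by `m` on the infinite cyclic group, written multiplicatively. -/
def cyclicPow (m : ℤ) : Multiplicative ℤ →* Multiplicative ℤ :=
  zpowersHom _ (Multiplicative.ofAdd m)

lemma cyclicPow_apply (m k : ℤ) :
    cyclicPow m (Multiplicative.ofAdd k) = Multiplicative.ofAdd (m * k) := by
  rw [cyclicPow, zpowersHom_apply, toAdd_ofAdd, ← ofAdd_zsmul, smul_eq_mul, mul_comm]

lemma cyclicPow_injective {m : ℤ} (hm : m ≠ 0) : Function.Injective (cyclicPow m) := by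
  intro x y h
  have h' : m * x.toAdd = m * y.toAdd :=
    Multiplicative.ofAdd.injective ((cyclicPow_apply m x.toAdd).symm.trans
      (h.trans (cyclicPow_apply m y.toAdd)))
  exact Multiplicative.toAdd.injective (mul_left_cancel₀ hm h')

lemma ofAdd_mem_range_cyclicPow {m c : ℤ} :
    Multiplicative.ofAdd c ∈ (cyclicPow m).range ↔ m ∣ c := by
  constructor
  · rintro ⟨x, hx⟩
    exact ⟨x.toAdd, Multiplicative.ofAdd.injective (hx.symm.trans (cyclicPow_apply m x.toAdd))⟩
  · rintro ⟨d, rfl⟩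
    exact ⟨Multiplicative.ofAdd d, cyclicPow_apply m d⟩

/-- The isomorphism `b ^ (m * k) ↦ b ^ (n * k)` between the subgroups of index `m` and `n` of an
infinite cyclic group. -/
noncomputable def cyclicEquiv {m n : ℤ} (hm : m ≠ 0) (hn : n ≠ 0) :
    (cyclicPow m).range ≃* (cyclicPow n).range :=
  (MonoidHom.ofInjective (cyclicPow_injective hm)).symm.trans
    (MonoidHom.ofInjective (cyclicPow_injective hn))

lemma cyclicEquiv_apply {m n : ℤ} (hm : m ≠ 0) (hn : n ≠ 0) (k : Multiplicative ℤ) :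
    cyclicEquiv hm hn ⟨cyclicPow m k, k, rfl⟩ = ⟨cyclicPow n k, k, rfl⟩ := by
  have h : (MonoidHom.ofInjective (cyclicPow_injective hm)).symm ⟨cyclicPow m k, k, rfl⟩ = k := by
    rw [MulEquiv.symm_apply_eq]
    rfl
  rw [cyclicEquiv, MulEquiv.trans_apply, h]
  rfl

/-- `BS(m,n)` as an HNN extension of an infinite cyclic group. -/
abbrev BSHNN {m n : ℤ} (hm : m ≠ 0) (hn : n ≠ 0) : Type :=
  HNNExtension (Multiplicative ℤ) _ _ (cyclicEquiv hm hn)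

lemma exists_hom_BSHNN {m n : ℤ} (hm : m ≠ 0) (hn : n ≠ 0) :
    ∃ f : (BS m n).Carrier →* BSHNN hm hn, f ((BS m n).proj genA) = HNNExtension.t ∧
      ∀ c : ℤ, f ((BS m n).proj genB ^ c) = HNNExtension.of (Multiplicative.ofAdd c) := by
  let g : FreeGroup (Fin 2) →* BSHNN hm hn :=
    FreeGroup.lift ![HNNExtension.t, HNNExtension.of (Multiplicative.ofAdd 1)]
  have hA : g genA = HNNExtension.t := by simp [g]
  have hB (c : ℤ) : g (genB ^ c) = HNNExtension.of (Multiplicative.ofAdd c) := by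
    rw [map_zpow]
    have : g genB = HNNExtension.of (Multiplicative.ofAdd 1) := by simp [g]
    rw [this, ← map_zpow, ← ofAdd_zsmul, smul_eq_mul, mul_one]
  have hker : (BS m n).ker ≤ g.ker := by
    refine Subgroup.normalClosure_le_normal (Set.singleton_subset_iff.2 ?_)
    change g _ = 1
    have h := HNNExtension.equiv_eq_conj (φ := cyclicEquiv hm hn)
      ⟨cyclicPow m (Multiplicative.ofAdd 1), _, rfl⟩
    rw [cyclicEquiv_apply] at h
    simp only [cyclicPow_apply, mul_one] at h
    rw [map_mul, map_inv, map_mul, map_mul, map_inv, hB, hB, hA, ← h, mul_inv_cancel]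
  refine ⟨QuotientGroup.lift _ g hker, hA, fun c => ?_⟩
  rw [← map_zpow]
  exact hB c

lemma ofAdd_mem_toSubgroup {m n c : ℤ} {u : ℤˣ} :
    Multiplicative.ofAdd c ∈
      HNNExtension.toSubgroup (cyclicPow m).range (cyclicPow n).range u ↔
      bsIndex m n u ∣ c := by
  rcases Int.units_eq_one_or u with rfl | rfl
  · exact ofAdd_mem_range_cyclicPow
  · exact ofAdd_mem_range_cyclicPow

/-- **Britton's lemma** for `BS(m,n)`: two reduced words that represent the same element have the
same sequence of letters `a` and `a⁻¹`. -/
lemma map_fst_eq_of_bsWord_eq {m n : ℤ} (hm : m ≠ 0) (hn : n ≠ 0) {c c' : ℤ}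
    {L L' : List (ℤˣ × ℤ)} (hL : BSReduced m n L) (hL' : BSReduced m n L')
    (h : bsWord m n c L = bsWord m n c' L') : L.map Prod.fst = L'.map Prod.fst := by
  obtain ⟨f, hfA, hfB⟩ := exists_hom_BSHNN hm hn
  let toRed (c : ℤ) (L : List (ℤˣ × ℤ)) (hL : BSReduced m n L) :
      HNNExtension.NormalWord.ReducedWord (Multiplicative ℤ)
        (cyclicPow m).range (cyclicPow n).range :=
    { head := Multiplicative.ofAdd c
      toList := L.map (Prod.map id Multiplicative.ofAdd)
      chain := by
        refine (List.isChain_map _).2 (List.IsChain.imp (fun x y hxy hx => hxy ?_) hL)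
        exact ofAdd_mem_toSubgroup.1 hx }
  have hprod (c : ℤ) (L : List (ℤˣ × ℤ)) (hL : BSReduced m n L) :
      (toRed c L hL).prod (cyclicEquiv hm hn) = f (bsWord m n c L) := by
    rw [HNNExtension.NormalWord.ReducedWord.prod, bsWord, map_mul, hfB, map_list_prod, List.map_map,
      List.map_map]
    simp only [toRed]
    congr 3
    funext x
    rw [Function.comp_apply, Function.comp_apply, map_mul, map_zpow, hfA, hfB]
    rfl
  have h1 := (HNNExtension.ReducedWord.map_fst_eq_and_of_prod_eq (cyclicEquiv hm hn)
    (w₁ := toRed c L hL) (w₂ := toRed c' L' hL') (by rw [hprod c L hL, hprod c' L' hL', h])).1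
  simpa only [toRed, List.map_map, Function.comp_def, Prod.map_fst, id] using h1

lemma length_eq_of_bsWord_eq {m n : ℤ} (hm : m ≠ 0) (hn : n ≠ 0) {c c' : ℤ}
    {L L' : List (ℤˣ × ℤ)} (hL : BSReduced m n L) (hL' : BSReduced m n L')
    (h : bsWord m n c L = bsWord m n c' L') : L.length = L'.length := by
  simpa using congrArg List.length (map_fst_eq_of_bsWord_eq hm hn hL hL' h)

lemma genB_zpow_injective {m n : ℤ} (hm : m ≠ 0) (hn : n ≠ 0) {c d : ℤ}
    (h : (BS m n).proj genB ^ c = (BS m n).proj genB ^ d) : c = d := by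
  obtain ⟨f, -, hfB⟩ := exists_hom_BSHNN hm hn
  have h' := congrArg f h
  rw [hfB, hfB] at h'
  exact Multiplicative.ofAdd.injective (HNNExtension.of_injective _ h')

lemma bsWord_mem_subgroupB_iff {m n : ℤ} (hm : m ≠ 0) (hn : n ≠ 0) {c : ℤ}
    {L : List (ℤˣ × ℤ)} (hL : BSReduced m n L) :
    bsWord m n c L ∈ subgroupB m n ↔ L = [] := by
  constructor
  · intro h
    obtain ⟨d, hd⟩ := Subgroup.mem_zpowers_iff.1 h
    rw [← bsWord_nil] at hd
    exact List.length_eq_zero_iff.1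
      (length_eq_of_bsWord_eq hm hn List.isChain_nil hL hd).symm
  · rintro rfl
    rw [bsWord_nil]
    exact Subgroup.zpow_mem _ (Subgroup.mem_zpowers _) _

lemma zpow_mem_subgroupBm_iff {m n : ℤ} (hm : m ≠ 0) (hn : n ≠ 0) {c : ℤ} :
    (BS m n).proj genB ^ c ∈ subgroupBm m n ↔ m ∣ c := by
  rw [subgroupBm, Subgroup.mem_zpowers_iff]
  constructor
  · rintro ⟨d, hd⟩
    rw [← zpow_mul] at hd
    exact ⟨d, (genB_zpow_injective hm hn hd).symm⟩
  · rintro ⟨d, rfl⟩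
    exact ⟨d, (zpow_mul _ _ _).symm⟩

lemma zpow_eq_one_iff_of_BS {m n : ℤ} (hm : m ≠ 0) (hn : n ≠ 0) {c : ℤ} :
    (BS m n).proj genB ^ c = 1 ↔ c = 0 := by
  constructor
  · intro h
    exact genB_zpow_injective hm hn (h.trans (zpow_zero _).symm)
  · rintro rfl
    exact zpow_zero _

/-- If `a * b ^ c * a⁻¹` lies in `⟨b⟩`, then `b ^ c` lies in `⟨b ^ m⟩`. -/
lemma dvd_of_conj_mem {m n : ℤ} (hm : m ≠ 0) (hn : n ≠ 0) {c : ℤ}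
    (h : (BS m n).proj genA * (BS m n).proj genB ^ c * ((BS m n).proj genA)⁻¹ ∈
      subgroupB m n) : m ∣ c := by
  by_contra hc
  have hred : BSReduced m n [(1, c), (-1, 0)] :=
    BSReduced.cons (List.isChain_singleton _) fun y _ hd => absurd hd hc
  have h' : bsWord m n 0 [(1, c), (-1, 0)] ∈ subgroupB m n := by
    simpa [bsWord_cons, bsWord_nil, mul_assoc] using h
  simpa using (bsWord_mem_subgroupB_iff hm hn hred).1 h'

/-! ### Functions that are eventually polynomial -/

/-- The integers `k` tend to infinity along `F` and they stabilize modulo each power of `m`. -/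
def StabilizesMod (m : ℤ) (F : Filter ℤ) : Prop :=
  Tendsto (fun k : ℤ => |k|) F atTop ∧ ∀ h : ℕ, ∃ r : ℤ, ∀ᶠ k in F, m ^ h ∣ k - r

/-- Along `F`, the function `c` is eventually given by a polynomial with coefficients in
`ℤ[1/m]`. -/
def EventuallyPolynomial (m : ℤ) (F : Filter ℤ) (c : ℤ → ℤ) : Prop :=
  ∃ (h : ℕ) (p : Polynomial ℤ), ∀ᶠ k in F, m ^ h * c k = p.eval k

section UniformForms

variable {m : ℤ} {F : Filter ℤ}

lemma StabilizesMod.eventually_lt_abs (hF : StabilizesMod m F) (N : ℤ) :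
    ∀ᶠ k in F, N < |k| :=
  hF.1.eventually (eventually_gt_atTop N)

lemma StabilizesMod.eventually_ne_zero (hF : StabilizesMod m F) : ∀ᶠ k in F, k ≠ 0 :=
  (hF.eventually_lt_abs 0).mono fun _ => abs_pos.1

lemma StabilizesMod.dvd_eval (hF : StabilizesMod m F) (h : ℕ) (p : Polynomial ℤ) :
    (∀ᶠ k in F, m ^ h ∣ p.eval k) ∨ ∀ᶠ k in F, ¬ m ^ h ∣ p.eval k := by
  obtain ⟨r, hr⟩ := hF.2 h
  have key : ∀ᶠ k in F, (m ^ h ∣ p.eval k ↔ m ^ h ∣ p.eval r) :=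
    hr.mono fun k hk => (dvd_iff_dvd_of_dvd_sub (hk.trans (Polynomial.sub_dvd_eval_sub k r p)))
  by_cases H : m ^ h ∣ p.eval r
  · exact Or.inl (key.mono fun k hk => hk.2 H)
  · exact Or.inr (key.mono fun k hk hd => H (hk.1 hd))

namespace EventuallyPolynomial

lemma const (m : ℤ) (F : Filter ℤ) (c : ℤ) : EventuallyPolynomial m F fun _ => c :=
  ⟨0, Polynomial.C c, Eventually.of_forall fun k => by simp⟩

lemma add {c d : ℤ → ℤ} (hc : EventuallyPolynomial m F c) (hd : EventuallyPolynomial m F d) :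
    EventuallyPolynomial m F fun k => c k + d k := by
  obtain ⟨h, p, hp⟩ := hc
  obtain ⟨h', q, hq⟩ := hd
  refine ⟨h + h', Polynomial.C (m ^ h') * p + Polynomial.C (m ^ h) * q, ?_⟩
  filter_upwards [hp, hq] with k h1 h2
  simp only [Polynomial.eval_add, Polynomial.eval_mul, Polynomial.eval_C, ← h1, ← h2]
  ring

/-- An eventually polynomial function is eventually zero or eventually nonzero. -/
lemma eq_zero_or (hm : m ≠ 0) (hF : StabilizesMod m F) {c : ℤ → ℤ}
    (hc : EventuallyPolynomial m F c) : (∀ᶠ k in F, c k = 0) ∨ ∀ᶠ k in F, c k ≠ 0 := by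
  obtain ⟨h, p, hp⟩ := hc
  have hmh : m ^ h ≠ 0 := pow_ne_zero _ hm
  by_cases hp0 : p = 0
  · left
    filter_upwards [hp] with k hk
    rw [hp0, Polynomial.eval_zero] at hk
    exact (mul_eq_zero.1 hk).resolve_left hmh
  · right
    have hroots : ∀ᶠ k in F, k ∉ p.roots.toFinset := by
      filter_upwards [hF.eventually_lt_abs (∑ r ∈ p.roots.toFinset, |r|)] with k hk hr
      exact absurd (Finset.single_le_sum (f := fun r : ℤ => |r|) (fun _ _ => abs_nonneg _) hr)
        (not_le.2 hk)
    filter_upwards [hp, hroots] with k hk hr hck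
    rw [hck, mul_zero] at hk
    exact hr (by rw [Multiset.mem_toFinset, Polynomial.mem_roots hp0]; exact hk.symm)

/-- Divisibility by `m` of an eventually polynomial function is eventually constant, and if it
holds, the exponent obtained by conjugation with `a` is again eventually polynomial. -/
lemma dvd_left_or (hm : m ≠ 0) (hF : StabilizesMod m F) {c : ℤ → ℤ}
    (hc : EventuallyPolynomial m F c) :
    (∃ d : ℤ → ℤ, (∀ᶠ k in F, c k = m * d k) ∧ EventuallyPolynomial m F fun k => k * d k) ∨
      ∀ᶠ k in F, ¬ m ∣ c k := by
  obtain ⟨h, p, hp⟩ := hc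
  have hmh : m ^ h ≠ 0 := pow_ne_zero _ hm
  rcases hF.dvd_eval (h + 1) p with H | H
  · left
    have hd : ∀ᶠ k in F, c k = m * (c k / m) := by
      filter_upwards [hp, H] with k hk hH
      rw [← hk, pow_succ] at hH
      exact (Int.mul_ediv_cancel' (Int.dvd_of_mul_dvd_mul_left hmh hH)).symm
    refine ⟨fun k => c k / m, hd, h + 1, Polynomial.X * p, ?_⟩
    filter_upwards [hp, hd] with k hk hdk
    rw [Polynomial.eval_mul, Polynomial.eval_X, ← hk, hdk,
      Int.mul_ediv_cancel_left _ hm]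
    ring
  · right
    filter_upwards [hp, H] with k hk hH hd
    rw [← hk, pow_succ] at hH
    exact hH (mul_dvd_mul_left _ hd)

/-- Divisibility of `c k` by `k` is eventually constant for an eventually polynomial function `c`,
and if it holds, the exponent obtained by conjugation with `a⁻¹` is again eventually
polynomial. -/
lemma dvd_right_or (hm : m ≠ 0) (hF : StabilizesMod m F) {c : ℤ → ℤ}
    (hc : EventuallyPolynomial m F c) :
    (∃ d : ℤ → ℤ, (∀ᶠ k in F, c k = k * d k) ∧ EventuallyPolynomial m F fun k => m * d k) ∨
      ∀ᶠ k in F, ¬ k ∣ c k := by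
  obtain ⟨h, p, hp⟩ := hc
  have hmh : m ^ h ≠ 0 := pow_ne_zero _ hm
  by_cases hp0 : p.coeff 0 = 0
  · obtain ⟨q, rfl⟩ := Polynomial.X_dvd_iff.2 hp0
    simp only [Polynomial.eval_mul, Polynomial.eval_X] at hp
    -- Here `m ^ h * c k = k * q k`, so `k ∣ c k` is equivalent to `m ^ h ∣ q k`.
    rcases hF.dvd_eval h q with H | H
    · left
      have hd : ∀ᶠ k in F, c k = k * (c k / k) := by
        filter_upwards [hp, H] with k hk ⟨e, he⟩
        rw [he, mul_left_comm] at hk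
        exact (Int.mul_ediv_cancel' ⟨e, mul_left_cancel₀ hmh hk⟩).symm
      refine ⟨fun k => c k / k, hd, h, Polynomial.C m * q, ?_⟩
      filter_upwards [hp, hd, hF.eventually_ne_zero] with k hk hdk hk0
      rw [hdk, mul_left_comm] at hk
      rw [Polynomial.eval_mul, Polynomial.eval_C, ← mul_left_cancel₀ hk0 hk]
      ring
    · right
      filter_upwards [hp, H, hF.eventually_ne_zero] with k hk hH hk0 ⟨e, he⟩
      rw [he, mul_left_comm] at hk
      exact hH ⟨e, (mul_left_cancel₀ hk0 hk).symm⟩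
  · right
    filter_upwards [hp, hF.eventually_lt_abs |p.coeff 0|] with k hk hlt hd
    have h1 : k ∣ p.eval k := hk ▸ hd.mul_left _
    have h2 : k ∣ p.eval k - p.eval 0 := by
      simpa using Polynomial.sub_dvd_eval_sub k 0 p
    have h3 : k ∣ p.coeff 0 := by
      rw [Polynomial.coeff_zero_eq_eval_zero]
      exact (dvd_iff_dvd_of_dvd_sub h2).1 h1
    have h4 := Int.le_of_dvd (abs_pos.2 hp0) ((abs_dvd_abs _ _).2 h3)
    exact absurd h4 (not_le.2 hlt)

lemma dvd_bsIndex_or (hm : m ≠ 0) (hF : StabilizesMod m F) {c : ℤ → ℤ}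
    (hc : EventuallyPolynomial m F c) (u : ℤˣ) :
    (∃ d : ℤ → ℤ, (∀ᶠ k in F, c k = bsIndex m k u * d k) ∧
      EventuallyPolynomial m F fun k => bsIndex m k (-u) * d k) ∨
      ∀ᶠ k in F, ¬ bsIndex m k u ∣ c k := by
  rcases Int.units_eq_one_or u with rfl | rfl
  · exact hc.dvd_left_or hm hF
  · exact hc.dvd_right_or hm hF

end EventuallyPolynomial

/-! ### Uniform reduced forms of words -/

/-- The list obtained from a list of letters whose exponents are functions by evaluating them. -/
def evalLetters (k : ℤ) (L : List (ℤˣ × (ℤ → ℤ))) : List (ℤˣ × ℤ) :=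
  L.map fun x => (x.1, x.2 k)

/-- Eventually along `F`, the word `w` is represented in `BS(m,k)` by the reduced word with
exponents `c k` and those of `L`, which are eventually polynomial functions of `k`. -/
structure IsUniformForm (m : ℤ) (F : Filter ℤ) (w : FreeGroup (Fin 2)) (c : ℤ → ℤ)
    (L : List (ℤˣ × (ℤ → ℤ))) : Prop where
  head : EventuallyPolynomial m F c
  letters : ∀ x ∈ L, EventuallyPolynomial m F x.2
  reduced : ∀ᶠ k in F, BSReduced m k (evalLetters k L)
  eq_bsWord : ∀ᶠ k in F, (BS m k).proj w = bsWord m k (c k) (evalLetters k L)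

lemma IsUniformForm.genB_zpow_mul {w : FreeGroup (Fin 2)} {c : ℤ → ℤ}
    {L : List (ℤˣ × (ℤ → ℤ))} (h : IsUniformForm m F w c L) (i : ℤ) :
    IsUniformForm m F (genB ^ i * w) (fun k => i + c k) L where
  head := (EventuallyPolynomial.const m F i).add h.head
  letters := h.letters
  reduced := h.reduced
  eq_bsWord := h.eq_bsWord.mono fun k hk => by
    rw [map_mul, map_zpow, hk, zpow_mul_bsWord]

/-- Multiplication by a letter `a` or `a⁻¹` either lengthens the uniform reduced form or cancels
with its first letter, for all large `k` simultaneously. -/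
lemma IsUniformForm.exists_genA_zpow_mul (hm : m ≠ 0) (hF : StabilizesMod m F)
    {w : FreeGroup (Fin 2)} {c : ℤ → ℤ} {L : List (ℤˣ × (ℤ → ℤ))}
    (h : IsUniformForm m F w c L) (u : ℤˣ) :
    ∃ c' L', IsUniformForm m F (genA ^ (u : ℤ) * w) c' L' := by
  have push (hne : ∀ᶠ k in F, ∀ y ∈ (evalLetters k L).head?, bsIndex m k u ∣ c k → u = y.1) :
      ∃ c' L', IsUniformForm m F (genA ^ (u : ℤ) * w) c' L' := by
    refine ⟨fun _ => 0, (u, c) :: L, .const m F 0, ?_, ?_, ?_⟩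
    · rintro x hx
      rcases List.mem_cons.1 hx with rfl | hx
      · exact h.head
      · exact h.letters x hx
    · filter_upwards [h.reduced, hne] with k hk hnek
      exact hk.cons hnek
    · filter_upwards [h.eq_bsWord] with k hk
      rw [evalLetters, List.map_cons, bsWord_cons, zpow_zero, one_mul, map_mul, map_zpow, hk]
      rfl
  rcases h.head.dvd_bsIndex_or hm hF u with ⟨d, hd, hd'⟩ | hd
  · cases L with
    | nil => exact push (Eventually.of_forall fun k y hy => by simp [evalLetters] at hy)
    | cons y L =>
      obtain ⟨v, e⟩ := y
      by_cases hv : u = v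
      · exact push (Eventually.of_forall fun k y hy _ => by
          simp only [evalLetters, List.map_cons, List.head?_cons, Option.mem_def,
            Option.some.injEq] at hy
          rw [← hy, hv])
      · have hv' : v = -u := by rw [Int.units_ne_iff_eq_neg.1 hv, neg_neg]
        subst hv'
        refine ⟨fun k => bsIndex m k (-u) * d k + e k, L,
          hd'.add (h.letters _ List.mem_cons_self),
          fun x hx => h.letters x (List.mem_cons_of_mem _ hx), ?_, ?_⟩
        · exact h.reduced.mono fun k hk => hk.tail
        · filter_upwards [h.eq_bsWord, hd] with k hk hdk
          rw [map_mul, map_zpow, hk, hdk]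
          exact bsWord_cancel ..
  · exact push (hd.mono fun k hk y _ hdvd => absurd hdvd hk)

/-- Every word has a uniform reduced form. -/
lemma exists_isUniformForm (hm : m ≠ 0) (hF : StabilizesMod m F) (w : FreeGroup (Fin 2)) :
    ∃ c L, IsUniformForm m F w c L := by
  suffices H : ∀ v, (∃ c L, IsUniformForm m F v c L) → ∃ c L, IsUniformForm m F (w * v) c L by
    have h1 : IsUniformForm m F 1 (fun _ => 0) [] :=
      ⟨.const m F 0, by simp, Eventually.of_forall fun _ => List.isChain_nil,
        Eventually.of_forall fun k => by
          rw [evalLetters, List.map_nil, bsWord_nil, zpow_zero, map_one]⟩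
    simpa using H 1 ⟨_, _, h1⟩
  have gen (i : Fin 2) (u : ℤˣ) (v : FreeGroup (Fin 2))
      (hv : ∃ c L, IsUniformForm m F v c L) :
      ∃ c L, IsUniformForm m F (FreeGroup.of i ^ (u : ℤ) * v) c L := by
    obtain ⟨c, L, h⟩ := hv
    fin_cases i
    · exact h.exists_genA_zpow_mul hm hF u
    · exact ⟨_, _, h.genB_zpow_mul u⟩
  induction w using FreeGroup.induction_on with
  | C1 => simp
  | of i => intro v hv; simpa using gen i 1 v hv
  | inv_of i _ => intro v hv; simpa using gen i (-1) v hv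
  | mul x y hx hy => intro v hv; simpa only [mul_assoc] using hx _ (hy v hv)

/-- A word that eventually lies in `⟨b⟩` is eventually the power of `b` with an eventually
polynomial exponent. -/
lemma exists_eventually_eq_zpow (hm : m ≠ 0) (hF : StabilizesMod m F) (w : FreeGroup (Fin 2)) :
    (∃ c, EventuallyPolynomial m F c ∧
      ∀ᶠ k in F, (BS m k).proj w = (BS m k).proj genB ^ c k) ∨
      ∀ᶠ k in F, (BS m k).proj w ∉ subgroupB m k := by
  obtain ⟨c, L, h⟩ := exists_isUniformForm hm hF w
  by_cases hL : L = []
  · subst hL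
    exact Or.inl ⟨c, h.head, h.eq_bsWord.mono fun k hk => by
      rw [hk, evalLetters, List.map_nil, bsWord_nil]⟩
  · right
    filter_upwards [h.reduced, h.eq_bsWord, hF.eventually_ne_zero] with k hr he hk
    rw [he, bsWord_mem_subgroupB_iff hm hk hr, evalLetters, List.map_eq_nil_iff]
    exact hL

/-- Membership of a word in `⟨b⟩` is eventually constant. -/
lemma eventually_mem_subgroupB_or (hm : m ≠ 0) (hF : StabilizesMod m F)
    (w : FreeGroup (Fin 2)) :
    (∀ᶠ k in F, (BS m k).proj w ∈ subgroupB m k) ∨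
      ∀ᶠ k in F, (BS m k).proj w ∉ subgroupB m k :=
  (exists_eventually_eq_zpow hm hF w).imp_left fun ⟨_, _, hw⟩ => hw.mono fun _ hk =>
    hk ▸ Subgroup.zpow_mem _ (Subgroup.mem_zpowers _) _

/-- Membership of a word in `⟨b ^ m⟩` is eventually constant. -/
lemma eventually_mem_subgroupBm_or (hm : m ≠ 0) (hF : StabilizesMod m F)
    (w : FreeGroup (Fin 2)) :
    (∀ᶠ k in F, (BS m k).proj w ∈ subgroupBm m k) ∨
      ∀ᶠ k in F, (BS m k).proj w ∉ subgroupBm m k := by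
  rcases exists_eventually_eq_zpow hm hF w with ⟨c, hc, hw⟩ | hw
  · rcases hc.dvd_left_or hm hF with ⟨d, hd, -⟩ | hd
    · left
      filter_upwards [hw, hd, hF.eventually_ne_zero] with k hk hdk hk0
      rw [hk, zpow_mem_subgroupBm_iff hm hk0, hdk]
      exact dvd_mul_right _ _
    · right
      filter_upwards [hw, hd, hF.eventually_ne_zero] with k hk hdk hk0
      rwa [hk, zpow_mem_subgroupBm_iff hm hk0]
  · exact Or.inr (hw.mono fun k hk hmem => hk (subgroupBm_le m k hmem))

/-- Triviality of a word in `BS(m,k)` is eventually constant. -/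
lemma eventually_mem_ker_or (hm : m ≠ 0) (hF : StabilizesMod m F) (w : FreeGroup (Fin 2)) :
    (∀ᶠ k in F, w ∈ (BS m k).ker) ∨ ∀ᶠ k in F, w ∉ (BS m k).ker := by
  have hker (k : ℤ) : w ∈ (BS m k).ker ↔ (BS m k).proj w = 1 :=
    (QuotientGroup.eq_one_iff w).symm
  simp only [hker]
  rcases exists_eventually_eq_zpow hm hF w with ⟨c, hc, hw⟩ | hw
  · have key : ∀ᶠ k in F, ((BS m k).proj w = 1 ↔ c k = 0) := by
      filter_upwards [hw, hF.eventually_ne_zero] with k hk hk0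
      rw [hk, zpow_eq_one_iff_of_BS hm hk0]
    rcases hc.eq_zero_or hm hF with h0 | h0
    · exact Or.inl (by filter_upwards [key, h0] with k hk hk0 using hk.2 hk0)
    · exact Or.inr (by filter_upwards [key, h0] with k hk hk0 h using hk0 (hk.1 h))
  · exact Or.inr (hw.mono fun k hk h => hk (h ▸ one_mem _))

end UniformForms

/-! ### Convergence of marked groups -/

namespace MarkedGroup

lemma mem_ker_iff_of_dist_lt {k : ℕ} {G H : MarkedGroup k} {w : FreeGroup (Fin k)}
    (h : dist G H < Real.exp (-(w.norm : ℝ))) : w ∈ G.ker ↔ w ∈ H.ker := by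
  by_contra hw
  have hne : G ≠ H := fun e => hw (by rw [e])
  have hle : sInf (diffLengths G H) ≤ w.norm := Nat.sInf_le ⟨w, rfl, hw⟩
  change distance G H < _ at h
  rw [distance, if_neg hne, Real.exp_lt_exp, neg_lt_neg_iff] at h
  exact absurd h (not_lt.2 (by exact_mod_cast hle))

lemma dist_le_of_forall_mem_ker_iff {k : ℕ} {G H : MarkedGroup k} {N : ℕ}
    (h : ∀ w : FreeGroup (Fin k), w.norm ≤ N → (w ∈ G.ker ↔ w ∈ H.ker)) :
    dist G H ≤ Real.exp (-(N : ℝ)) := by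
  change distance G H ≤ _
  by_cases hne : G = H
  · rw [distance, if_pos hne]
    exact (Real.exp_pos _).le
  · rw [distance, if_neg hne, Real.exp_le_exp, neg_le_neg_iff, Nat.cast_le]
    obtain ⟨w, hw, hw'⟩ := Nat.sInf_mem (diffLengths_nonempty hne)
    by_contra! hlt
    exact hw' (h w (hw.trans_le hlt.le))

lemma finite_norm_le (k N : ℕ) : {w : FreeGroup (Fin k) | w.norm ≤ N}.Finite :=
  Set.Finite.of_finite_image ((List.finite_length_le (Fin k × Bool) N).subset
    (by rintro _ ⟨w, hw, rfl⟩; exact hw)) FreeGroup.toWord_injective.injOn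

/-- Convergence of marked groups is pointwise eventual constancy of the set of trivial words. -/
lemma tendsto_nhds_iff {k : ℕ} {α : Type*} {l : Filter α} {f : α → MarkedGroup k}
    {G : MarkedGroup k} :
    Tendsto f l (𝓝 G) ↔ ∀ w, ∀ᶠ x in l, (w ∈ (f x).ker ↔ w ∈ G.ker) := by
  constructor
  · intro h w
    exact (Metric.tendsto_nhds.1 h _ (Real.exp_pos _)).mono fun x => mem_ker_iff_of_dist_lt
  · intro h
    refine Metric.tendsto_nhds.2 fun ε hε => ?_
    have hlim : Tendsto (fun N : ℕ => Real.exp (-(N : ℝ))) atTop (𝓝 0) :=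
      Real.tendsto_exp_neg_atTop_nhds_zero.comp tendsto_natCast_atTop_atTop
    obtain ⟨N, hN⟩ := (hlim.eventually (gt_mem_nhds hε)).exists
    filter_upwards [(finite_norm_le k N).eventually_all.2 fun w _ => h w] with x hx
    exact (dist_le_of_forall_mem_ker_iff fun w hw => hx w hw).trans_lt hN

lemma exists_tendsto {k : ℕ} {α : Type*} {l : Filter α} {f : α → MarkedGroup k}
    (h : ∀ w, (∀ᶠ x in l, w ∈ (f x).ker) ∨ ∀ᶠ x in l, w ∉ (f x).ker) :
    ∃ G, Tendsto f l (𝓝 G) := by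
  refine ⟨⟨{ carrier := {w | ∀ᶠ x in l, w ∈ (f x).ker}
             one_mem' := Eventually.of_forall fun x => one_mem _
             mul_mem' := fun hv hw => by
               filter_upwards [hv, hw] with x h1 h2 using mul_mem h1 h2
             inv_mem' := fun hw => hw.mono fun x hx => inv_mem hx },
    ⟨fun w hw g => hw.mono fun x hx => (f x).normal.conj_mem w hx g⟩⟩,
    tendsto_nhds_iff.2 fun w => ?_⟩
  rcases h w with hw | hw
  · exact hw.mono fun x hx => iff_of_true hx hw
  · by_cases hw' : ∀ᶠ x in l, w ∈ (f x).ker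
    · exact hw'.mono fun x hx => iff_of_true hx hw'
    · exact hw.mono fun x hx => iff_of_false hx hw'

end MarkedGroup

lemma stabilizesMod_approachFilter (m : ℤ) (ξ : MAdicInt m) :
    StabilizesMod m (approachFilter m ξ) := by
  refine ⟨tendsto_comap.mono_left inf_le_left, fun h => ?_⟩
  obtain ⟨r, hr⟩ := ZMod.intCast_surjective (ξ.1 h)
  refine ⟨r, ?_⟩
  have h1 : Tendsto (fun k : ℤ => (k : MAdicInt m)) (approachFilter m ξ) (𝓝 ξ) :=
    tendsto_comap.mono_left inf_le_right
  have h2 : Continuous fun x : MAdicInt m => x.1 h :=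
    (continuous_apply h).comp continuous_subtype_val
  have h3 : ∀ᶠ y in 𝓝 (ξ.1 h), y = ξ.1 h := by
    rw [nhds_discrete]
    exact eventually_pure.2 rfl
  filter_upwards [((h2.tendsto ξ).comp h1).eventually h3] with k hk
  have hk' : ((k : ℤ) : ZMod (m.natAbs ^ h)) = (r : ZMod (m.natAbs ^ h)) := by
    rw [hr, ← hk]
    rfl
  have hdvd := (ZMod.intCast_eq_intCast_iff_dvd_sub _ _ _).1 hk'.symm
  rwa [Nat.cast_pow, Int.natCast_natAbs, ← abs_pow, abs_dvd] at hdvd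

lemma tendsto_approachFilter {m : ℤ} {ξ : MAdicInt m} {ξs : ℕ → ℤ}
    (habs : Tendsto (fun n => |ξs n|) atTop atTop)
    (hlim : Tendsto (fun n => (ξs n : MAdicInt m)) atTop (𝓝 ξ)) :
    Tendsto ξs atTop (approachFilter m ξ) :=
  tendsto_inf.2 ⟨tendsto_comap_iff.2 habs, tendsto_comap_iff.2 hlim⟩

/-- The limit that defines `BSbar m ξ` exists. -/
lemma tendsto_BSbar {m : ℤ} (hm : m ≠ 0) (ξ : MAdicInt m) :
    Tendsto (fun k => BS m k) (approachFilter m ξ) (𝓝 (BSbar m ξ)) :=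
  tendsto_nhds_limUnder (MarkedGroup.exists_tendsto fun w =>
    eventually_mem_ker_or hm (stabilizesMod_approachFilter m ξ) w)

/-! ### Vertices and edges of the limit graph -/

section LimitGraph

variable {m : ℤ} {F : Filter ℤ} {ξ ξ' : ℕ → ℤ}

/-- A property of integers that is eventually constant along `F` may be tested along any sequence
that converges along `F`. -/
lemma eventually_comp_iff_of_or {P : ℤ → Prop} (hξ : Tendsto ξ atTop F)
    (h : (∀ᶠ k in F, P k) ∨ ∀ᶠ k in F, ¬ P k) :
    (∀ᶠ n in atTop, P (ξ n)) ↔ ∀ᶠ k in F, P k := by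
  refine ⟨fun hn => h.resolve_right fun hk => ?_, fun hk => hξ.eventually hk⟩
  obtain ⟨n, h1, h2⟩ := (hn.and (hξ.eventually hk)).exists
  exact h2 h1

lemma limVertex_eq_iff (hm : m ≠ 0) (hF : StabilizesMod m F) (hξ : Tendsto ξ atTop F)
    (v w : FreeGroup (Fin 2)) : limVertex m ξ v = limVertex m ξ w ↔
      ∀ᶠ k in F, (BS m k).proj (v⁻¹ * w) ∈ subgroupB m k := by
  rw [← eventually_comp_iff_of_or hξ (eventually_mem_subgroupB_or hm hF _)]
  refine Quotient.eq''.trans (eventually_congr (Eventually.of_forall fun n => ?_))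
  rw [map_mul, map_inv]
  exact QuotientGroup.eq

lemma limEdge_eq_iff (hm : m ≠ 0) (hF : StabilizesMod m F) (hξ : Tendsto ξ atTop F)
    (v w : FreeGroup (Fin 2)) : limEdge m ξ v = limEdge m ξ w ↔
      ∀ᶠ k in F, (BS m k).proj (v⁻¹ * w) ∈ subgroupBm m k := by
  rw [← eventually_comp_iff_of_or hξ (eventually_mem_subgroupBm_or hm hF _)]
  refine Quotient.eq''.trans (eventually_congr (Eventually.of_forall fun n => ?_))
  rw [map_mul, map_inv]
  exact QuotientGroup.eq

/-- Two families with the same fibres have canonically equivalent ranges. -/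
lemma exists_equiv_of_fibres {W α β : Type*} {f : W → α} {g : W → β}
    (h : ∀ v w, f v = f w ↔ g v = g w) :
    ∃ e : {x // ∃ w, x = f w} ≃ {y // ∃ w, y = g w},
      ∀ w, e ⟨f w, w, rfl⟩ = ⟨g w, w, rfl⟩ := by
  let e : {x // ∃ w, x = f w} → {y // ∃ w, y = g w} := fun x => ⟨g x.2.choose, _, rfl⟩
  have he (w : W) : e ⟨f w, w, rfl⟩ = ⟨g w, w, rfl⟩ := by
    refine Subtype.ext ((h _ _).1 ?_)
    exact (Exists.choose_spec (⟨w, rfl⟩ : ∃ w', f w = f w')).symm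
  refine ⟨Equiv.ofBijective e ⟨?_, ?_⟩, he⟩
  · rintro ⟨_, v, rfl⟩ ⟨_, w, rfl⟩ hvw
    rw [he, he, Subtype.mk.injEq] at hvw
    exact Subtype.ext ((h _ _).2 hvw)
  · rintro ⟨_, w, rfl⟩
    exact ⟨_, he w⟩

/-- The limit graph depends only on the filter along which the sequence converges. -/
lemma exists_equivariant_iso (hm : m ≠ 0) (hF : StabilizesMod m F) (hξ : Tendsto ξ atTop F)
    (hξ' : Tendsto ξ' atTop F) :
    ∃ φ : OrientedGraph.Iso (limitGraph m ξ) (limitGraph m ξ'),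
      φ.Equivariant (limitAction m ξ) (limitAction m ξ') := by
  obtain ⟨eV, hV⟩ := exists_equiv_of_fibres (f := limVertex m ξ) (g := limVertex m ξ')
    fun v w => (limVertex_eq_iff hm hF hξ v w).trans (limVertex_eq_iff hm hF hξ' v w).symm
  obtain ⟨eE, hE⟩ := exists_equiv_of_fibres (f := limEdge m ξ) (g := limEdge m ξ')
    fun v w => (limEdge_eq_iff hm hF hξ v w).trans (limEdge_eq_iff hm hF hξ' v w).symm
  refine ⟨⟨eV, eE, ?_, ?_⟩, fun v => ⟨?_, ?_⟩⟩
  · rintro ⟨_, w, rfl⟩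
    exact (congrArg (limitGraph m ξ').o (hE w)).trans (hV w).symm
  · rintro ⟨_, w, rfl⟩
    exact (congrArg (limitGraph m ξ').t (hE w)).trans (hV (w * genA⁻¹)).symm
  · rintro ⟨_, w, rfl⟩
    refine (hV (v * w)).trans ?_
    change _ = ((limitAction m ξ') v).1.1 (eV _)
    rw [hV]
    rfl
  · rintro ⟨_, w, rfl⟩
    refine (hE (v * w)).trans ?_
    change _ = ((limitAction m ξ') v).1.2 (eE _)
    rw [hE]
    rfl

/-- Words that are eventually trivial act trivially on the limit graph. -/
lemma limitAction_eq_one (hm : m ≠ 0) (hF : StabilizesMod m F) (hξ : Tendsto ξ atTop F)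
    {v : FreeGroup (Fin 2)} (hv : ∀ᶠ k in F, v ∈ (BS m k).ker) : limitAction m ξ v = 1 := by
  have key (w : FreeGroup (Fin 2)) : ∀ᶠ k in F, (BS m k).proj ((v * w)⁻¹ * w) = 1 :=
    hv.mono fun k hk => by
      have hk' : (BS m k).proj v = 1 := (QuotientGroup.eq_one_iff v).2 hk
      rw [map_mul, map_inv, map_mul, hk', one_mul, inv_mul_cancel]
  refine Subtype.ext (Prod.ext (Equiv.ext ?_) (Equiv.ext ?_))
  · rintro ⟨_, w, rfl⟩
    exact Subtype.ext ((limVertex_eq_iff hm hF hξ (v * w) w).2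
      ((key w).mono fun k hk => hk ▸ one_mem _))
  · rintro ⟨_, w, rfl⟩
    exact Subtype.ext ((limEdge_eq_iff hm hF hξ (v * w) w).2
      ((key w).mono fun k hk => hk ▸ one_mem _))

/-! ### The limit graph is a tree -/

/-- The element `g` of `BS(m,n)` is represented by a reduced word with `l` letters `a`, `a⁻¹`. -/
def HasALength (m n : ℤ) (g : (BS m n).Carrier) (l : ℕ) : Prop :=
  ∃ c L, BSReduced m n L ∧ g = bsWord m n c L ∧ L.length = l

lemma HasALength.genB_zpow_mul {m n : ℤ} {g : (BS m n).Carrier} {l : ℕ}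
    (h : HasALength m n g l) (i : ℤ) : HasALength m n ((BS m n).proj genB ^ i * g) l := by
  obtain ⟨c, L, hL, rfl, hl⟩ := h
  exact ⟨i + c, L, hL, zpow_mul_bsWord .., hl⟩

/-- The cosets `x⁻¹⟨b⟩` and `y⁻¹⟨b⟩` are joined by an edge of the Bass-Serre tree. Passing to
inverses turns multiplication on the right into multiplication on the left. -/
def BSNeighbour (m n : ℤ) (x y : (BS m n).Carrier) : Prop :=
  ∃ (i j : ℤ) (u : ℤˣ), y = (BS m n).proj genB ^ j * ((BS m n).proj genA ^ (u : ℤ) *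
    ((BS m n).proj genB ^ i * x))

/-- A vertex of the Bass-Serre tree has at most one neighbour that is not further away from the
base vertex. -/
lemma BSNeighbour.mul_inv_mem {m n : ℤ} (hm : m ≠ 0) (hn : n ≠ 0) {x y z : (BS m n).Carrier}
    {l ly lz : ℕ} (hx : HasALength m n x l) (hy : HasALength m n y ly)
    (hz : HasALength m n z lz) (hxy : BSNeighbour m n x y) (hxz : BSNeighbour m n x z)
    (hly : ly ≤ l) (hlz : lz ≤ l) : y * z⁻¹ ∈ subgroupB m n := by
  obtain ⟨c, L, hL, rfl, rfl⟩ := hx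
  have key {y : (BS m n).Carrier} {ly : ℕ} (hy : HasALength m n y ly)
      (hxy : BSNeighbour m n (bsWord m n c L) y) (hly : ly ≤ L.length) :
      ∃ c', y = bsWord m n c' L.tail := by
    obtain ⟨i, j, u, hiju⟩ := hxy
    rcases bsWord_neighbour m n i j c u hL with ⟨c', L', h, hL', hlen⟩ | ⟨c', h⟩
    · obtain ⟨d, M, hM, rfl, rfl⟩ := hy
      have := length_eq_of_bsWord_eq hm hn hM hL' (hiju.trans h)
      omega
    · exact ⟨c', hiju.trans h⟩
  obtain ⟨d, rfl⟩ := key hy hxy hly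
  obtain ⟨e, rfl⟩ := key hz hxz hlz
  have h := zpow_mul_bsWord m n (d - e) e L.tail
  rw [sub_add_cancel] at h
  rw [← h, mul_inv_cancel_right]
  exact Subgroup.zpow_mem _ (Subgroup.mem_zpowers _) _

lemma bsNeighbour_of_mem {m n : ℤ} {x y z : (BS m n).Carrier}
    (hx : z * x⁻¹ ∈ subgroupB m n)
    (hy : (BS m n).proj genA * z * y⁻¹ ∈ subgroupB m n) :
    BSNeighbour m n x y ∧ BSNeighbour m n y x := by
  obtain ⟨i, hi⟩ := Subgroup.mem_zpowers_iff.1 hx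
  obtain ⟨j, hj⟩ := Subgroup.mem_zpowers_iff.1 hy
  refine ⟨⟨i, -j, 1, ?_⟩, ⟨j, -i, -1, ?_⟩⟩
  · rw [zpow_neg, hi, hj]
    simp [mul_assoc]
  · rw [zpow_neg, hi, hj]
    simp [mul_assoc]

lemma exists_eventually_hasALength (hm : m ≠ 0) (hF : StabilizesMod m F)
    (w : FreeGroup (Fin 2)) : ∃ l, ∀ᶠ k in F, HasALength m k ((BS m k).proj w) l := by
  obtain ⟨c, L, h⟩ := exists_isUniformForm hm hF w
  refine ⟨L.length, ?_⟩
  filter_upwards [h.reduced, h.eq_bsWord] with k hr he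
  exact ⟨c k, _, hr, he, by rw [evalLetters, List.length_map]⟩

/-- Each vertex of the limit graph has a depth: the eventual distance to the base vertex in the
Bass-Serre trees. -/
lemma exists_depth (hm : m ≠ 0) (hF : StabilizesMod m F) (hξ : Tendsto ξ atTop F) :
    ∃ d : (limitGraph m ξ).V → ℕ, ∀ w, ∀ᶠ k in F,
      HasALength m k ((BS m k).proj w⁻¹) (d ⟨limVertex m ξ w, w, rfl⟩) := by
  have h (x : (limitGraph m ξ).V) : ∃ l, ∀ w, x.1 = limVertex m ξ w →
      ∀ᶠ k in F, HasALength m k ((BS m k).proj w⁻¹) l := by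
    obtain ⟨_, v, rfl⟩ := x
    obtain ⟨l, hl⟩ := exists_eventually_hasALength hm hF v⁻¹
    refine ⟨l, fun w hw => ?_⟩
    filter_upwards [hl, (limVertex_eq_iff hm hF hξ w v).1 hw.symm] with k hk hmem
    obtain ⟨i, hi⟩ := Subgroup.mem_zpowers_iff.1 hmem
    have hw' : (BS m k).proj w⁻¹ = (BS m k).proj genB ^ i * (BS m k).proj v⁻¹ := by
      rw [hi, ← map_mul, mul_inv_cancel_right]
    rw [hw']
    exact hk.genB_zpow_mul i
  choose d hd using h
  exact ⟨d, fun w => hd _ w rfl⟩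

lemma eventually_bsNeighbour (hm : m ≠ 0) (hF : StabilizesMod m F) (hξ : Tendsto ξ atTop F)
    {v w : FreeGroup (Fin 2)} (h : (limitGraph m ξ).toSimpleGraph.Adj
      ⟨limVertex m ξ v, v, rfl⟩ ⟨limVertex m ξ w, w, rfl⟩) :
    ∀ᶠ k in F, BSNeighbour m k ((BS m k).proj v⁻¹) ((BS m k).proj w⁻¹) := by
  have key {v w e : FreeGroup (Fin 2)} (h1 : limVertex m ξ e = limVertex m ξ v)
      (h2 : limVertex m ξ (e * genA⁻¹) = limVertex m ξ w) :
      ∀ᶠ k in F, BSNeighbour m k ((BS m k).proj v⁻¹) ((BS m k).proj w⁻¹) ∧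
        BSNeighbour m k ((BS m k).proj w⁻¹) ((BS m k).proj v⁻¹) := by
    filter_upwards [(limVertex_eq_iff hm hF hξ _ _).1 h1,
      (limVertex_eq_iff hm hF hξ _ _).1 h2] with k hk1 hk2
    refine bsNeighbour_of_mem (z := (BS m k).proj e⁻¹) ?_ ?_
    · rwa [← map_inv, ← map_mul, inv_inv]
    · rw [mul_inv_rev, inv_inv] at hk2
      rwa [← map_inv, ← map_mul, ← map_mul, inv_inv]
  obtain ⟨-, ⟨_, e, rfl⟩, ⟨h1, h2⟩ | ⟨h1, h2⟩⟩ := h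
  · exact (key (congrArg Subtype.val h1) (congrArg Subtype.val h2)).mono fun k hk => hk.1
  · exact (key (congrArg Subtype.val h1) (congrArg Subtype.val h2)).mono fun k hk => hk.2

/-- A graph is acyclic if it has a depth function such that each vertex has at most one neighbour
that is not deeper: on a cycle, both neighbours of a deepest vertex are such neighbours. -/
lemma SimpleGraph.isAcyclic_of_depth {V : Type*} (G : SimpleGraph V) (d : V → ℕ)
    (h : ∀ ⦃v x y⦄, G.Adj v x → G.Adj v y → d x ≤ d v → d y ≤ d v → x = y) :
    G.IsAcyclic := by
  classical
  intro u c hc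
  obtain ⟨v, hv, hmax⟩ := c.support.toFinset.exists_max_image d
    ⟨u, List.mem_toFinset.2 c.start_mem_support⟩
  have hv' : v ∈ c.support := List.mem_toFinset.1 hv
  have hc' := hc.rotate hv'
  have hmem {x : V} (hx : x ∈ (c.rotate v hv').support) : d x ≤ d v := by
    refine hmax x (List.mem_toFinset.2 ?_)
    rw [SimpleGraph.Walk.rotate, SimpleGraph.Walk.mem_support_append_iff] at hx
    rcases hx with hx | hx
    · exact c.support_dropUntil_subset_support hv' hx
    · exact c.support_takeUntil_subset_support hv' hx
  have hnil := hc'.not_nil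
  exact hc'.snd_ne_penultimate (h ((c.rotate v hv').adj_snd hnil)
    ((c.rotate v hv').adj_penultimate hnil).symm
    (hmem (SimpleGraph.Walk.getVert_mem_support _ _))
    (hmem (SimpleGraph.Walk.getVert_mem_support _ _)))

lemma limVertex_ne_mul_genA_inv (hm : m ≠ 0) (hF : StabilizesMod m F)
    (hξ : Tendsto ξ atTop F) (w : FreeGroup (Fin 2)) :
    limVertex m ξ w ≠ limVertex m ξ (w * genA⁻¹) := by
  intro h
  have hne : F.NeBot := hξ.neBot
  obtain ⟨k, hk, hk0⟩ :=
    (((limVertex_eq_iff hm hF hξ _ _).1 h).and hF.eventually_ne_zero).exists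
  have hred : BSReduced m k [(-1, 0)] := List.isChain_singleton _
  have hmem : bsWord m k 0 [(-1, 0)] ∈ subgroupB m k := by
    simpa [bsWord_cons, bsWord_nil] using hk
  simpa using (bsWord_mem_subgroupB_iff hm hk0 hred).1 hmem

/-- The limit graph has no multiple edges, not even with opposite orientations. -/
lemma injective_limitGraph_ends (hm : m ≠ 0) (hF : StabilizesMod m F)
    (hξ : Tendsto ξ atTop F) :
    Function.Injective fun e => s((limitGraph m ξ).o e, (limitGraph m ξ).t e) := by
  have hne : F.NeBot := hξ.neBot
  rintro ⟨_, v, rfl⟩ ⟨_, w, rfl⟩ h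
  rcases Sym2.eq_iff.1 h with ⟨h1, h2⟩ | ⟨h1, h2⟩
  · refine Subtype.ext ((limEdge_eq_iff hm hF hξ v w).2 ?_)
    filter_upwards [(limVertex_eq_iff hm hF hξ v w).1 (congrArg Subtype.val h1),
      (limVertex_eq_iff hm hF hξ (v * genA⁻¹) (w * genA⁻¹)).1 (congrArg Subtype.val h2),
      hF.eventually_ne_zero] with k hk1 hk2 hk0
    obtain ⟨i, hi⟩ := Subgroup.mem_zpowers_iff.1 hk1
    rw [← hi, zpow_mem_subgroupBm_iff hm hk0]
    refine dvd_of_conj_mem hm hk0 ?_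
    rw [hi]
    simpa [mul_assoc] using hk2
  · exfalso
    obtain ⟨k, ⟨hk1, hk2⟩, hk0⟩ :=
      ((((limVertex_eq_iff hm hF hξ v (w * genA⁻¹)).1 (congrArg Subtype.val h1)).and
        ((limVertex_eq_iff hm hF hξ (v * genA⁻¹) w).1 (congrArg Subtype.val h2))).and
        hF.eventually_ne_zero).exists
    obtain ⟨i, hi⟩ := Subgroup.mem_zpowers_iff.1 hk1
    obtain ⟨j, hj⟩ := Subgroup.mem_zpowers_iff.1 hk2
    -- `v⁻¹ * w` would equal both `b ^ i * a` and `a⁻¹ * b ^ j`.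
    have he : bsWord m k i [(1, 0)] = bsWord m k 0 [(-1, j)] := by
      rw [bsWord_cons, bsWord_cons, bsWord_nil, bsWord_nil, hi, hj]
      simp [mul_assoc]
    have := map_fst_eq_of_bsWord_eq hm hk0 (List.isChain_singleton _)
      (List.isChain_singleton _) he
    simp at this

lemma connected_limitGraph (hm : m ≠ 0) (hF : StabilizesMod m F) (hξ : Tendsto ξ atTop F) :
    (limitGraph m ξ).toSimpleGraph.Connected := by
  let vtx (w : FreeGroup (Fin 2)) : (limitGraph m ξ).V := ⟨limVertex m ξ w, w, rfl⟩
  have stepA (v : FreeGroup (Fin 2)) :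
      (limitGraph m ξ).toSimpleGraph.Reachable (vtx v) (vtx (v * genA⁻¹)) := by
    refine SimpleGraph.Adj.reachable ⟨fun h => ?_, ⟨limEdge m ξ v, v, rfl⟩, Or.inl ⟨rfl, rfl⟩⟩
    exact limVertex_ne_mul_genA_inv hm hF hξ v (congrArg Subtype.val h)
  have stepB (v : FreeGroup (Fin 2)) : vtx v = vtx (v * genB) := by
    refine Subtype.ext ((limVertex_eq_iff hm hF hξ _ _).2 (Eventually.of_forall fun k => ?_))
    rw [inv_mul_cancel_left]
    exact Subgroup.mem_zpowers _
  have key (w : FreeGroup (Fin 2)) :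
      ∀ v, (limitGraph m ξ).toSimpleGraph.Reachable (vtx v) (vtx (v * w)) := by
    induction w using FreeGroup.induction_on with
    | C1 => intro v; rw [mul_one]
    | of i =>
      intro v
      fin_cases i
      · have h := (stepA (v * genA)).symm
        rwa [mul_inv_cancel_right] at h
      · change SimpleGraph.Reachable _ _ (vtx (v * genB))
        rw [← stepB v]
    | inv_of i ih =>
      intro v
      have h := (ih (v * (FreeGroup.of i)⁻¹)).symm
      rwa [inv_mul_cancel_right] at h
    | mul x y hx hy =>
      intro v
      rw [← mul_assoc]
      exact (hx v).trans (hy (v * x))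
  have : Nonempty (limitGraph m ξ).V := ⟨vtx 1⟩
  refine SimpleGraph.Connected.mk ?_
  rintro ⟨_, v, rfl⟩ ⟨_, w, rfl⟩
  have h := key (v⁻¹ * w) v
  rwa [mul_inv_cancel_left] at h

lemma isTree_limitGraph (hm : m ≠ 0) (hF : StabilizesMod m F) (hξ : Tendsto ξ atTop F) :
    (limitGraph m ξ).IsTree := by
  refine ⟨?_, injective_limitGraph_ends hm hF hξ, connected_limitGraph hm hF hξ, ?_⟩
  · rintro ⟨_, w, rfl⟩ h
    exact limVertex_ne_mul_genA_inv hm hF hξ w (congrArg Subtype.val h)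
  · obtain ⟨d, hd⟩ := exists_depth hm hF hξ
    refine SimpleGraph.isAcyclic_of_depth _ d ?_
    rintro ⟨_, v, rfl⟩ ⟨_, x, rfl⟩ ⟨_, y, rfl⟩ hx hy hdx hdy
    refine Subtype.ext ((limVertex_eq_iff hm hF hξ x y).2 ?_)
    filter_upwards [hd v, hd x, hd y, eventually_bsNeighbour hm hF hξ hx,
      eventually_bsNeighbour hm hF hξ hy, hF.eventually_ne_zero] with k hv hx hy hvx hvy hk
    have h := BSNeighbour.mul_inv_mem hm hk hv hx hy hvx hvy hdx hdy
    rwa [← map_inv, ← map_mul, inv_inv] at h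

end LimitGraph

theorem theorem3p5 (m : ℤ) (hm : m ≠ 0) (ξ : MAdicInt m) (ξs : ℕ → ℤ)
    (habs : Filter.Tendsto (fun n => |ξs n|) Filter.atTop Filter.atTop)
    (hlim : Filter.Tendsto (fun n => (ξs n : MAdicInt m)) Filter.atTop (nhds ξ)) :
    -- the marked groups `BS(m,ξ_n)` converge to the marked group `B̄S̄(m,ξ)`
    Filter.Tendsto (fun n => BS m (ξs n)) Filter.atTop (nhds (BSbar m ξ)) ∧
    -- (a)
    (limitGraph m ξs).IsTree ∧
    -- (b)
    (∀ ξs' : ℕ → ℤ,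
      Filter.Tendsto (fun n => |ξs' n|) Filter.atTop Filter.atTop →
      Filter.Tendsto (fun n => (ξs' n : MAdicInt m)) Filter.atTop (nhds ξ) →
      ∃ φ : OrientedGraph.Iso (limitGraph m ξs) (limitGraph m ξs'),
        φ.Equivariant (limitAction m ξs) (limitAction m ξs')) ∧
    -- (c)
    (∃ ψ : (BSbar m ξ).Carrier →* (limitGraph m ξs).Aut,
      ψ.comp (BSbar m ξ).proj = limitAction m ξs) := by
  have hF := stabilizesMod_approachFilter m ξ
  have hξ := tendsto_approachFilter habs hlim
  have hBS := tendsto_BSbar hm ξ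
  refine ⟨hBS.comp hξ, isTree_limitGraph hm hF hξ, fun ξs' habs' hlim' =>
    exists_equivariant_iso hm hF hξ (tendsto_approachFilter habs' hlim'), ?_⟩
  refine ⟨QuotientGroup.lift _ (limitAction m ξs) fun v hv => ?_, MonoidHom.ext fun v => rfl⟩
  exact limitAction_eq_one hm hF hξ
    ((MarkedGroup.tendsto_nhds_iff.1 hBS v).mono fun k hk => hk.2 hv)
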